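/- Let $G$ be a finite abstract simplicial complex, i.e. a finite set of non-empty finite sets (its faces) such that every non-empty subset of a face is a face. Let $G_1$ be the graph whose vertices are the faces of $G$, two distinct faces being adjacent if one is contained in the other, and let $A$ be the adjacency matrix of the graph on the same vertex set in which two distinct faces are adjacent if they intersect. Put $L=1+A$. For a finite simple graph $\Gamma$, a simplex of $\Gamma$ is a non-empty set $y$ of pairwise adjacent vertices, with $\dim y=|y|-1$, and $\chi(\Gamma)=\sum_y(-1)^{\dim y}$, summed over the simplices $y$ of $\Gamma$. For a vertex $x$ of $G_1$ let $S(x)$ be the subgraph of $G_1$ induced on the neighbours of $x$. Let $v_k$ be the number of $k$-dimensional simplices of $G_1$ and $f_1(x)=\sum_{k\ge1}v_{k-1}x^k$. Then $L$ is invertible, and $\eta(G)=\operatorname{tr}(L-L^{-1})$ satisfies $$\eta(G)=f_1'(0)-f_1'(-1)=2v_1-3v_2+4v_3-\cdots .$$ Equivalently, $\operatorname{tr}(L^{-1})=f_1'(-1)$. Moreover $$\eta(G)=\sum_{x\in V(G_1)}\chi(S(x))=\sum_{y}(-1)^{1+\dim y}(1+\dim y),$$ where $y$ runs over the simplices of $G_1$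 of positive dimension. -/

import Mathlib

open Polynomial

namespace HydrogenTrace

/-- The Barycentric refinement graph `G₁` of a complex `G`: its vertices are the faces of `G`, and
two distinct faces are adjacent if one is a subset of the other. -/
def barycentricGraph {ι : Type*} (G : PreAbstractSimplicialComplex ι) : SimpleGraph G.faces where
  Adj x y := x ≠ y ∧ ((x : Finset ι) ⊆ y ∨ (y : Finset ι) ⊆ x)
  symm := ⟨fun _ _ h => ⟨h.1.symm, h.2.symm⟩⟩
  loopless := ⟨fun _ h => h.1 rfl⟩

/-- The connection graph `G'` of a complex `G`: its vertices are the faces of `G`, and two distinct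
faces are adjacent if they intersect. -/
def connectionGraph {ι : Type*} (G : PreAbstractSimplicialComplex ι) : SimpleGraph G.faces where
  Adj x y := x ≠ y ∧ ¬ Disjoint (x : Finset ι) (y : Finset ι)
  symm := ⟨fun _ _ h => ⟨h.1.symm, fun hd => h.2 hd.symm⟩⟩
  loopless := ⟨fun _ h => h.1 rfl⟩

/-- The Whitney complex of a graph: the vertex sets of its nonempty complete subgraphs. -/
def whitneyComplex {V : Type*} (Γ : SimpleGraph V) : PreAbstractSimplicialComplex V where
  faces := {s | s.Nonempty ∧ Γ.IsClique (s : Set V)}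
  isRelLowerSet_faces := fun _ hs =>
    ⟨hs.1, fun _ hts ht => ⟨ht, hs.2.subset (Finset.coe_subset.2 hts)⟩⟩

/-- The unit sphere `S(x)` of a vertex: the graph induced on the neighbours of `x`. -/
def unitSphere {V : Type*} (Γ : SimpleGraph V) (x : V) : SimpleGraph (Γ.neighborSet x) :=
  Γ.induce (Γ.neighborSet x)

/-- The dimension of a simplex, one less than its cardinality (simplices are nonempty). -/
def dim {ι : Type*} (s : Finset ι) : ℕ := s.card - 1

/-- The entry `v_k` of the `f`-vector: the number of `k`-dimensional simplices. -/
noncomputable def fVector {ι : Type*} (K : PreAbstractSimplicialComplex ι) (k : ℕ) : ℕ :=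
  {s ∈ K.faces | dim s = k}.ncard

/-- The Euler characteristic of a finite complex, the sum of `(-1) ^ dim s` over its simplices. -/
noncomputable def eulerChar {ι : Type*} (K : PreAbstractSimplicialComplex ι) : ℤ :=
  ∑ᶠ s ∈ K.faces, (-1) ^ dim s

/-- The generating function `f(x) = ∑_{k ≥ 1} v_{k-1} x^k` of the `f`-vector of a finite complex.
No term is lost by stopping at the number of simplices, see `coeff_generatingFunction`. -/
noncomputable def generatingFunction {ι : Type*} (K : PreAbstractSimplicialComplex ι) : ℝ[X] :=
  ∑ k ∈ Finset.Icc 1 K.faces.ncard, C (fVector K (k - 1) : ℝ) * X ^ k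

theorem fVector_eq_zero {ι : Type*} (K : PreAbstractSimplicialComplex ι) (hK : K.faces.Finite)
    {k : ℕ} (hk : K.faces.ncard ≤ k) : fVector K k = 0 := by
  have h : {s ∈ K.faces | dim s = k} = ∅ := by
    refine Set.eq_empty_iff_forall_notMem.2 ?_
    rintro s ⟨hs, hd⟩
    have hne := (K.isRelLowerSet_faces hs).1
    have hsub : (fun a : ι => ({a} : Finset ι)) '' (s : Set ι) ⊆ K.faces := by
      rintro _ ⟨a, ha, rfl⟩
      exact (K.isRelLowerSet_faces hs).2 (Finset.singleton_subset_iff.2 ha) ⟨a, by simp⟩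
    have h1 := Set.ncard_le_ncard hsub hK
    rw [Set.ncard_image_of_injective _ Finset.singleton_injective, Set.ncard_coe_finset] at h1
    have h2 := hne.card_pos
    unfold dim at hd
    omega
  rw [fVector, h, Set.ncard_empty]

theorem coeff_generatingFunction {ι : Type*} (K : PreAbstractSimplicialComplex ι)
    (hK : K.faces.Finite) (k : ℕ) :
    (generatingFunction K).coeff (k + 1) = fVector K k := by
  simp only [generatingFunction, finsetSum_coeff, coeff_C_mul_X_pow]
  rw [Finset.sum_ite_eq]
  by_cases h : k + 1 ≤ K.faces.ncard
  · simp [h]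
  · simp [h, fVector_eq_zero K hK (show K.faces.ncard ≤ k by omega)]

theorem coeff_zero_generatingFunction {ι : Type*} (K : PreAbstractSimplicialComplex ι) :
    (generatingFunction K).coeff 0 = 0 := by
  simp only [generatingFunction, finsetSum_coeff, coeff_C_mul_X_pow]
  rw [Finset.sum_ite_eq]
  simp

open Classical in
/-- The connection Laplacian `L = 1 + A`, with `A` the adjacency matrix of the connection graph. -/
noncomputable def connectionLaplacian {ι : Type*} (G : PreAbstractSimplicialComplex ι) :
    Matrix G.faces G.faces ℝ :=
  1 + (connectionGraph G).adjMatrix ℝ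

/-- The functional `η(G) = tr(L - L⁻¹)`. -/
noncomputable def eta {ι : Type*} [DecidableEq ι] (G : PreAbstractSimplicialComplex ι)
    [Fintype G.faces] : ℝ :=
  (connectionLaplacian G - (connectionLaplacian G)⁻¹).trace

end HydrogenTrace

/-! Let Z be `zetaMatrix` and D be `parityMatrix`, so D² = 1. The sum of (-1)^dim over the non-empty
subsets of x ∩ y is 1, or 0 if x ∩ y is empty; this says L = Z D Zᵀ. Alternating sums over
nontrivial Boolean intervals vanish; this says Z D Z = D, so Z⁻¹ = D Z D. Hence L⁻¹ = D Zᵀ D Z D,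
and cyclicity of the trace gives tr L⁻¹ = tr(Z Zᵀ D) = -∑_z (-1)^|z| (2^|z| - 1).

The simplices of G₁ are the non-empty chains of faces, so f₁'(-1) = -∑_y |y| (-1)^|y| over chains y.
The chains with greatest element z contribute (-1)^|z| (2^|z| - 1) to the inner sum
(`chainSum_mul_neg_one_pow`), so both sides agree face by face. Also tr L = |G| = f₁'(0).

For the spheres, deleting x matches the positive-dimensional simplices through x with the simplices
of S(x); summing over x counts each simplex once per vertex. -/

namespace HydrogenTrace

open Finset

/-! ### Alternating sums over Boolean lattices -/

section Powerset

variable {ι : Type*}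

theorem sum_powerset_neg_two_pow_card (s : Finset ι) :
    ∑ t ∈ s.powerset, (-1 : ℤ) ^ #t * 2 ^ #t = (-1) ^ #s := by
  have h := Finset.sum_pow_mul_eq_add_pow (-2 : ℤ) 1 s
  simp only [one_pow, mul_one] at h
  simp only [← mul_pow]
  norm_num at h ⊢
  exact h

/-- The interval is a translate of the power set of t \ s. This is Möbius inversion for inclusion,
used for Z D Z = D. -/
theorem sum_Icc_neg_one_pow_card [DecidableEq ι] {s t : Finset ι} (h : s ⊆ t) :
    ∑ u ∈ Icc s t, (-1 : ℤ) ^ #u = if s = t then (-1) ^ #t else 0 := by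
  rw [Icc_eq_image_powerset h, sum_image]
  · have hcard : ∀ u ∈ (t \ s).powerset, (-1 : ℤ) ^ #(s ∪ u) = (-1) ^ #s * (-1) ^ #u := by
      intro u hu
      rw [card_union_of_disjoint, pow_add]
      exact (disjoint_sdiff.mono_right (mem_powerset.1 hu))
    rw [sum_congr rfl hcard, ← mul_sum, sum_powerset_neg_one_pow_card]
    by_cases hst : s = t
    · simp [hst]
    · have : ¬ t ⊆ s := fun h' => hst (h.antisymm h')
      simp [hst, sdiff_eq_empty_iff_subset, this]
  · intro u hu v hv huv
    have hu' := disjoint_sdiff.mono_right (mem_powerset.1 hu)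
    have hv' := disjoint_sdiff.mono_right (mem_powerset.1 hv)
    have := congrArg (· \ s) huv
    simpa [union_sdiff_left, hu'.sdiff_eq_right, hv'.sdiff_eq_right, hu'.symm.sdiff_eq_left,
      hv'.symm.sdiff_eq_left] using this

end Powerset

/-! ### Weighted sums over chains, grouped by greatest element -/

section ChainSum

variable {α : Type*} [PartialOrder α]

theorem exists_isGreatest_of_isChain {y : Finset α} (hy : y.Nonempty)
    (hc : IsChain (· ≤ ·) (y : Set α)) : ∃ z, IsGreatest (y : Set α) z := by
  obtain ⟨z, hz⟩ := y.exists_maximal hy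
  refine ⟨z, hz.1, fun w hw => ?_⟩
  rcases hc.total (mem_coe.2 hz.1) hw with h | h
  · exact hz.2 hw h
  · exact h

variable [Fintype α]

open Classical in
/-- The sum of `f (#y)` over the chains `y` with greatest element `z`. -/
noncomputable def chainSum (f : ℕ → ℤ) (z : α) : ℤ :=
  ∑ y ∈ univ.filter fun y : Finset α =>
    IsChain (· ≤ ·) (y : Set α) ∧ IsGreatest (y : Set α) z, f (#y)

open Classical in
-- Every non-empty finite chain has exactly one greatest element. Quantifying over all greatest
-- elements avoids choosing it.
theorem sum_chainSum (f : ℕ → ℤ) (p : α → Prop) [DecidablePred p] :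
    ∑ z with p z, chainSum f z =
      ∑ y ∈ univ.filter fun y : Finset α => y.Nonempty ∧ IsChain (· ≤ ·) (y : Set α) ∧
        ∀ z, IsGreatest (y : Set α) z → p z, f (#y) := by
  simp only [chainSum, sum_filter]
  have h1 : ∀ z : α, (if p z then ∑ y : Finset α,
      (if IsChain (· ≤ ·) (y : Set α) ∧ IsGreatest (y : Set α) z then f (#y) else 0) else 0) =
      ∑ y : Finset α, (if p z ∧ IsChain (· ≤ ·) (y : Set α) ∧ IsGreatest (y : Set α) z
        then f (#y) else 0) := by
    intro z
    by_cases hz : p z <;> simp [hz]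
  rw [sum_congr rfl fun z _ => h1 z, sum_comm]
  refine sum_congr rfl fun y _ => ?_
  by_cases hy : y.Nonempty ∧ IsChain (· ≤ ·) (y : Set α)
  · obtain ⟨z, hz⟩ := exists_isGreatest_of_isChain hy.1 hy.2
    rw [sum_eq_single z]
    · refine if_congr ⟨fun h => ⟨hy.1, hy.2, fun w hw => hw.unique hz ▸ h.1⟩,
        fun h => ⟨h.2.2 z hz, hy.2, hz⟩⟩ rfl rfl
    · intro w _ hw
      exact if_neg fun h => hw (h.2.2.unique hz)
    · simp
  · rw [if_neg fun h => hy ⟨h.1, h.2.1⟩]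
    exact sum_eq_zero fun z _ => if_neg fun h => hy ⟨⟨z, h.2.2.1⟩, h.2.1⟩

/-- Removing z from a chain leaves either nothing or a chain with greatest element below z. This
recursion drives the inductions on faces. -/
theorem chainSum_eq [DecidableLT α] (f : ℕ → ℤ) (z : α) :
    chainSum f z = f 1 + ∑ w with w < z, chainSum (fun n => f (n + 1)) w := by
  classical
  rw [sum_chainSum]
  have key : chainSum f z = ∑ y ∈ univ.filter fun y : Finset α =>
      IsChain (· ≤ ·) (y : Set α) ∧ ∀ a ∈ y, a < z, f (#y + 1) := by
    refine sum_bij' (fun y _ => y.erase z) (fun y _ => insert z y) ?_ ?_ ?_ ?_ ?_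
    · intro y hy
      simp only [mem_filter, mem_univ, true_and] at hy ⊢
      refine ⟨hy.1.mono (by simp), fun a ha => ?_⟩
      rw [mem_erase] at ha
      exact lt_of_le_of_ne (hy.2.2 ha.2) ha.1
    · intro y hy
      simp only [mem_filter, mem_univ, true_and] at hy ⊢
      refine ⟨?_, by simp, ?_⟩
      · rw [coe_insert]
        exact hy.1.insert fun a ha _ => Or.inr (hy.2 a ha).le
      · intro a ha
        rcases mem_insert.1 (mem_coe.1 ha) with rfl | ha
        · exact le_rfl
        · exact (hy.2 a ha).le
    · intro y hy
      simp only [mem_filter, mem_univ, true_and] at hy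
      exact insert_erase hy.2.1
    · intro y hy
      simp only [mem_filter, mem_univ, true_and] at hy
      exact erase_insert fun h => lt_irrefl z (hy.2 z h)
    · intro y hy
      simp only [mem_filter, mem_univ, true_and] at hy
      rw [card_erase_add_one (mem_coe.1 hy.2.1)]
  -- The empty remainder comes from the chain {z} and gives the term `f 1`.
  rw [key, ← add_sum_erase _ _ (show (∅ : Finset α) ∈ _ by simp)]
  congr 1
  refine sum_congr ?_ fun _ _ => rfl
  ext y
  simp only [mem_erase, mem_filter, mem_univ, true_and, ← nonempty_iff_ne_empty]
  refine and_congr_right fun hy => and_congr_right fun hc =>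
    ⟨fun h z hz => h z hz.1, fun h a ha => ?_⟩
  obtain ⟨w, hw⟩ := exists_isGreatest_of_isChain hy hc
  exact (hw.2 ha).trans_lt (h w hw)

theorem chainSum_neg (f : ℕ → ℤ) (z : α) :
    chainSum (fun n => - f n) z = - chainSum f z := by
  simp [chainSum]

theorem chainSum_sub (f g : ℕ → ℤ) (z : α) :
    chainSum (fun n => f n - g n) z = chainSum f z - chainSum g z := by
  simp [chainSum]

end ChainSum

/-! ### Chain sums in a simplicial complex -/

section Faces

variable {ι : Type*} [DecidableEq ι] (G : PreAbstractSimplicialComplex ι) [Fintype G.faces]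

/-- Membership of `T` is conditional so that `T` may be an intersection of two faces, possibly
empty. -/
theorem sum_faces_subset {M : Type*} [AddCommMonoid M] {T : Finset ι}
    (hT : T.Nonempty → T ∈ G.faces) (g : Finset ι → M) :
    ∑ z : G.faces with z.1 ⊆ T, g z = ∑ s ∈ T.powerset with s.Nonempty, g s := by
  refine sum_bij (fun z _ => z.1) ?_ ?_ ?_ ?_
  · intro z hz
    simp only [mem_filter, mem_univ, true_and, mem_powerset] at hz ⊢
    exact ⟨hz, (G.isRelLowerSet_faces z.2).1⟩
  · intro a _ b _ h
    exact Subtype.ext h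
  · intro s hs
    simp only [mem_filter, mem_powerset] at hs
    exact ⟨⟨s, (G.isRelLowerSet_faces (hT (hs.2.mono hs.1))).2 hs.1 hs.2⟩, by simpa using hs.1, rfl⟩
  · intro _ _
    rfl

theorem sum_powerset_nonempty {M : Type*} [AddCommGroup M] (T : Finset ι) (g : Finset ι → M) :
    ∑ s ∈ T.powerset with s.Nonempty, g s = ∑ s ∈ T.powerset, g s - g ∅ := by
  rw [← sum_erase_eq_sub (empty_mem_powerset T)]
  refine sum_congr ?_ fun _ _ => rfl
  ext s
  simp [nonempty_iff_ne_empty, and_comm]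

theorem sum_faces_lt [DecidableLT G.faces] (z : G.faces) (g : Finset ι → ℤ) :
    ∑ w : G.faces with w < z, g w = ∑ s ∈ z.1.powerset, g s - g ∅ - g z := by
  rw [← sum_powerset_nonempty, ← sum_faces_subset G fun _ => z.2,
    ← sum_erase_eq_sub (f := fun w : G.faces => g w) (a := z) (by simp)]
  refine sum_congr ?_ fun _ _ => rfl
  ext w
  simp only [mem_erase, mem_filter, mem_univ, true_and, lt_iff_le_and_ne]
  exact and_comm

/-- By induction the value is -1 - ∑ (-1)^|s| over non-empty proper subsets s of z, and the sum over
all subsets is 0. -/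
theorem chainSum_neg_one_pow (z : G.faces) :
    chainSum (fun n => (-1) ^ n) z = (-1) ^ #z.1 := by
  classical
  induction z using WellFoundedLT.induction with
  | ind z ih =>
    have h : ∀ w : G.faces, chainSum (fun n => (-1) ^ (n + 1)) w =
        - chainSum (fun n => (-1) ^ n) w := fun w => by
      rw [← chainSum_neg]; simp only [pow_succ, mul_neg_one]
    have ih' : ∑ w with w < z, chainSum (fun n => (-1) ^ n) w = ∑ w with w < z, (-1) ^ #w.1 :=
      sum_congr rfl fun w hw => ih w (mem_filter.1 hw).2
    rw [chainSum_eq _ z]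
    simp only [h, sum_neg_distrib]
    rw [ih',
      sum_faces_lt G z fun s => (-1) ^ #s, sum_powerset_neg_one_pow_card_of_nonempty
      (G.isRelLowerSet_faces z.2).1]
    simp

/-- In the recursion, (-1)^|w| (2^|w| - 1) + (-1)^|w| = (-2)^|w|, and the sum of these over all
subsets of z is (-1)^|z|. -/
theorem chainSum_mul_neg_one_pow (z : G.faces) :
    chainSum (fun n => n * (-1) ^ n) z = (-1) ^ #z.1 * (2 ^ #z.1 - 1) := by
  classical
  induction z using WellFoundedLT.induction with
  | ind z ih =>
    have h : ∀ w : G.faces, chainSum (fun n => ((n + 1 : ℕ) : ℤ) * (-1) ^ (n + 1)) w =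
        - chainSum (fun n => n * (-1) ^ n) w - (-1) ^ #w.1 := fun w => by
      rw [← chainSum_neg_one_pow, ← chainSum_neg, ← chainSum_sub]
      congr 1
      ext n
      push_cast
      ring
    have ih' : ∑ w with w < z, chainSum (fun n => n * (-1) ^ n) w =
        ∑ w with w < z, (-1) ^ #w.1 * (2 ^ #w.1 - 1) := sum_congr rfl fun w hw => ih w (mem_filter.1 hw).2
    rw [chainSum_eq _ z]
    simp only [h, sum_sub_distrib, sum_neg_distrib]
    rw [ih',
      sum_faces_lt G z fun s => (-1) ^ #s * (2 ^ #s - 1), sum_faces_lt G z fun s => (-1) ^ #s,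
      sum_powerset_neg_one_pow_card_of_nonempty (G.isRelLowerSet_faces z.2).1]
    simp only [mul_sub, sum_sub_distrib, sum_powerset_neg_two_pow_card, mul_one,
      sum_powerset_neg_one_pow_card_of_nonempty (G.isRelLowerSet_faces z.2).1]
    simp

end Faces

/-! ### Generating functions and unit spheres -/

section Graph

variable {V : Type*} [Fintype V]

open Classical in
theorem fVector_eq_card (K : PreAbstractSimplicialComplex V) (k : ℕ) :
    fVector K k = #{s : Finset V | s ∈ K.faces ∧ dim s = k} := by
  rw [fVector, ← Set.ncard_coe_finset]
  congr 1
  ext s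
  simp

theorem dim_add_one {ι : Type*} {K : PreAbstractSimplicialComplex ι} {s : Finset ι}
    (hs : s ∈ K.faces) : dim s + 1 = #s :=
  Nat.sub_add_cancel (K.isRelLowerSet_faces hs).1.card_pos

open Classical in
theorem generatingFunction_eq (K : PreAbstractSimplicialComplex V) :
    generatingFunction K = ∑ s : Finset V with s ∈ K.faces, X ^ #s := by
  ext k
  rw [finsetSum_coeff]
  simp only [coeff_X_pow]
  rw [← sum_filter, filter_filter, sum_const, nsmul_eq_mul, mul_one]
  rcases k with _ | k
  · rw [coeff_zero_generatingFunction, eq_comm, Nat.cast_eq_zero, card_eq_zero,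
      filter_eq_empty_iff]
    intro s _ hs
    have := dim_add_one hs.1
    omega
  · rw [coeff_generatingFunction K (Set.toFinite _), fVector_eq_card]
    congr 2
    ext s
    simp only [mem_filter, mem_univ, true_and]
    refine and_congr_right fun hs => ?_
    rw [← dim_add_one hs]
    omega

open Classical in
theorem eval_derivative_generatingFunction (K : PreAbstractSimplicialComplex V) (t : ℝ) :
    (generatingFunction K).derivative.eval t =
      ∑ s : Finset V with s ∈ K.faces, (#s : ℝ) * t ^ (#s - 1) := by
  rw [generatingFunction_eq, derivative_sum, eval_finsetSum]
  refine sum_congr rfl fun s _ => ?_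
  rw [derivative_X_pow, eval_mul, eval_pow, eval_X, eval_C]

open Classical in
theorem eval_derivative_zero_sub_eval_derivative_neg_one (K : PreAbstractSimplicialComplex V) :
    (generatingFunction K).derivative.eval 0 - (generatingFunction K).derivative.eval (-1) =
      ((∑ s : Finset V with s ∈ K.faces ∧ 0 < dim s, (-1 : ℤ) ^ #s * #s : ℤ) : ℝ) := by
  rw [eval_derivative_generatingFunction, eval_derivative_generatingFunction, ← sum_sub_distrib,
    ← filter_filter, sum_filter (p := fun s => 0 < dim s)]
  push_cast
  refine sum_congr rfl fun s hs => ?_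
  have hs' := dim_add_one (mem_filter.1 hs).2
  rw [← hs']
  -- Vertices cancel, because 0^0 = (-1)^0; in higher dimension the term at 0 vanishes.
  rcases hd : dim s with _ | d
  · simp
  · simp
    ring

open Classical in
theorem hasSum_fVector (K : PreAbstractSimplicialComplex V) :
    HasSum (fun k : ℕ => (-1 : ℝ) ^ k * (k + 2) * (fVector K (k + 1) : ℝ))
      ((∑ s : Finset V with s ∈ K.faces ∧ 0 < dim s, (-1 : ℤ) ^ #s * #s : ℤ) : ℝ) := by
  -- A simplex of dimension k + 1 needs k + 2 vertices, so the series is a finite sum.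
  have hz : ∀ k ∉ range (Fintype.card V), (-1 : ℝ) ^ k * (k + 2) * (fVector K (k + 1) : ℝ) = 0 := by
    intro k hk
    rw [fVector_eq_card, filter_eq_empty_iff.2, card_empty, Nat.cast_zero, mul_zero]
    rintro s _ ⟨hs, hd⟩
    have := dim_add_one hs
    have := s.card_le_univ
    rw [mem_range] at hk
    omega
  convert hasSum_sum_of_ne_finset_zero (L := .unconditional ℕ) hz using 1
  push_cast
  rw [← sum_fiberwise_of_maps_to (s := univ.filter fun s => s ∈ K.faces ∧ 0 < dim s)
    (t := range (Fintype.card V)) (g := fun s => dim s - 1)]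
  · refine sum_congr rfl fun k _ => ?_
    rw [fVector_eq_card, filter_filter, mul_comm _ ((#_ : ℕ) : ℝ), ← nsmul_eq_mul]
    have : (univ.filter fun s : Finset V => (s ∈ K.faces ∧ 0 < dim s) ∧ dim s - 1 = k) =
        univ.filter fun s : Finset V => s ∈ K.faces ∧ dim s = k + 1 := by
      ext s
      simp only [mem_filter, mem_univ, true_and, and_assoc]
      refine and_congr_right fun _ => ?_
      omega
    rw [this]
    refine sum_eq_card_nsmul fun s hs => ?_
    simp only [mem_filter, mem_univ, true_and] at hs
    rw [← dim_add_one hs.1, hs.2]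
    push_cast
    ring
  · intro s hs
    simp only [mem_filter, mem_univ, true_and] at hs
    have := dim_add_one hs.1
    have := s.card_le_univ
    rw [mem_range]
    omega

open Classical in
theorem eulerChar_eq_sum (K : PreAbstractSimplicialComplex V) :
    eulerChar K = ∑ s : Finset V with s ∈ K.faces, (-1) ^ dim s := by
  rw [eulerChar, ← finsum_mem_finset_eq_sum]
  simp

open Classical in
-- Coning with x maps simplices of S(x) bijectively to simplices through x with one more vertex, so
-- the dimension of the former has the parity of `#s` - 2.
theorem eulerChar_unitSphere (Γ : SimpleGraph V) (x : V) :
    eulerChar (whitneyComplex (unitSphere Γ x)) =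
      ∑ s : Finset V with (s ∈ (whitneyComplex Γ).faces ∧ 0 < dim s) ∧ x ∈ s, (-1) ^ #s := by
  rw [eulerChar_eq_sum]
  refine sum_bij' (fun s _ => insert x (s.map (Function.Embedding.subtype _)))
    (fun s _ => s.subtype (· ∈ Γ.neighborSet x)) ?_ ?_ ?_ ?_ ?_
  · intro s hs
    simp only [mem_filter, mem_univ, true_and] at hs
    have hx : x ∉ s.map (Function.Embedding.subtype _) := by simp
    simp only [mem_filter, mem_univ, true_and, mem_insert_self, and_true]
    refine ⟨⟨insert_nonempty _ _, ?_⟩, ?_⟩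
    · rw [coe_insert]
      refine SimpleGraph.IsClique.insert ?_ ?_
      · intro a ha b hb hab
        simp only [coe_map, Set.mem_image, mem_coe] at ha hb
        obtain ⟨a, ha, rfl⟩ := ha
        obtain ⟨b, hb, rfl⟩ := hb
        exact hs.2 ha hb fun h => hab (h ▸ rfl)
      · intro b hb _
        simp only [coe_map, Set.mem_image, mem_coe] at hb
        obtain ⟨b, hb, rfl⟩ := hb
        exact b.2
    · have := hs.1.card_pos
      rw [dim, card_insert_of_notMem hx, card_map]
      omega
  · intro s hs
    simp only [mem_filter, mem_univ, true_and] at hs ⊢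
    obtain ⟨⟨⟨hne, hc⟩, hd⟩, hx⟩ := hs
    -- Positive dimension ensures that a vertex remains after deleting x.
    have h1 : 1 < #s := by unfold dim at hd; omega
    obtain ⟨b, hb, hbx⟩ := exists_mem_ne h1 x
    refine ⟨⟨⟨b, hc hx hb hbx.symm⟩, by simpa using hb⟩, ?_⟩
    intro a ha b hb hab
    simp only [mem_coe, mem_subtype] at ha hb
    exact hc ha hb fun h => hab (Subtype.ext h)
  · intro s hs
    ext a
    have hax : a.1 ≠ x := (SimpleGraph.Adj.ne a.2).symm
    have ha : Γ.Adj x a.1 := a.2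
    simp [hax, ha]
  · intro s hs
    simp only [mem_filter, mem_univ, true_and] at hs
    obtain ⟨⟨⟨hne, hc⟩, hd⟩, hx⟩ := hs
    ext a
    simp only [mem_insert, subtype_map, mem_filter]
    refine ⟨?_, fun ha => ?_⟩
    · rintro (rfl | h)
      exacts [hx, h.1]
    · by_cases hax : a = x
      · exact Or.inl hax
      · exact Or.inr ⟨ha, hc hx ha (Ne.symm hax)⟩
  · intro s hs
    simp only [mem_filter, mem_univ, true_and] at hs
    have hx : x ∉ s.map (Function.Embedding.subtype _) := by simp
    rw [card_insert_of_notMem hx, card_map, ← dim_add_one (K := whitneyComplex _) hs]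
    ring

open Classical in
theorem sum_eulerChar_unitSphere (Γ : SimpleGraph V) :
    ∑ x, eulerChar (whitneyComplex (unitSphere Γ x)) =
      ∑ s : Finset V with s ∈ (whitneyComplex Γ).faces ∧ 0 < dim s, (-1 : ℤ) ^ #s * (#s : ℤ) := by
  simp only [eulerChar_unitSphere, ← filter_filter]
  simp only [sum_filter (p := fun s => _ ∈ s)]
  rw [sum_comm]
  refine sum_congr rfl fun s _ => ?_
  rw [← sum_filter, sum_const, nsmul_eq_mul, mul_comm]
  simp

end Graph

/-! ### Factorisation, inverse and trace of the connection Laplacian -/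

section Laplacian

variable {ι : Type*} [DecidableEq ι] (G : PreAbstractSimplicialComplex ι)

theorem connectionLaplacian_apply (x y : G.faces) :
    connectionLaplacian G x y = if Disjoint x.1 y.1 then 0 else 1 := by
  by_cases h : x = y
  · subst h
    have := (G.isRelLowerSet_faces x.2).1
    simp [connectionLaplacian, this.ne_empty]
  · have hadj : (connectionGraph G).Adj x y ↔ ¬ Disjoint x.1 y.1 := and_iff_right h
    simp [connectionLaplacian, h, hadj]

variable [Fintype G.faces]

/-- The incidence matrix of the inclusion order on the faces. -/
def zetaMatrix : Matrix G.faces G.faces ℝ :=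
  .of fun x z => if z.1 ⊆ x.1 then 1 else 0

/-- The diagonal matrix with entries `(-1) ^ dim x`. -/
def parityMatrix : Matrix G.faces G.faces ℝ :=
  .diagonal fun x => (-1) ^ (#x.1 + 1)

open Matrix

theorem parityMatrix_mul_self : parityMatrix G * parityMatrix G = 1 := by
  rw [parityMatrix, diagonal_mul_diagonal, ← diagonal_one]
  congr 1
  ext x
  rw [← mul_pow]
  simp

theorem connectionLaplacian_eq :
    connectionLaplacian G = zetaMatrix G * parityMatrix G * (zetaMatrix G)ᵀ := by
  ext x y
  rw [connectionLaplacian_apply, Matrix.mul_apply]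
  simp only [parityMatrix, mul_diagonal, zetaMatrix, transpose_apply, of_apply]
  have h1 : ∀ z : G.faces, ((if z.1 ⊆ x.1 then 1 else 0) * (-1) ^ (#z.1 + 1) *
      (if z.1 ⊆ y.1 then 1 else 0) : ℝ) =
      if z.1 ⊆ x.1 ∩ y.1 then (-1) ^ (#z.1 + 1) else 0 := by
    intro z
    by_cases hx : z.1 ⊆ x.1 <;> by_cases hy : z.1 ⊆ y.1 <;> simp [subset_inter_iff, hx, hy]
  rw [sum_congr rfl fun z _ => h1 z, ← sum_filter, sum_faces_subset G
    (fun h => (G.isRelLowerSet_faces x.2).2 inter_subset_left h) fun s => (-1 : ℝ) ^ (#s + 1),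
    sum_powerset_nonempty]
  have h2 := sum_powerset_neg_one_pow_card (x := x.1 ∩ y.1)
  simp only [← disjoint_iff_inter_eq_empty] at h2
  have h3 := congrArg (Int.cast : ℤ → ℝ) h2
  push_cast at h3
  simp only [pow_succ, ← sum_mul, h3]
  by_cases h : Disjoint x.1 y.1 <;> simp [h]

theorem zetaMatrix_mul_parityMatrix_mul_zetaMatrix :
    zetaMatrix G * parityMatrix G * zetaMatrix G = parityMatrix G := by
  ext x y
  rw [Matrix.mul_apply]
  simp only [parityMatrix, mul_diagonal, zetaMatrix, of_apply]
  have h1 : ∀ z : G.faces, ((if z.1 ⊆ x.1 then 1 else 0) * (-1) ^ (#z.1 + 1) *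
      (if y.1 ⊆ z.1 then 1 else 0) : ℝ) =
      if z.1 ⊆ x.1 then (if y.1 ⊆ z.1 then (-1) ^ (#z.1 + 1) else 0) else 0 := by
    intro z
    by_cases hx : z.1 ⊆ x.1 <;> by_cases hy : y.1 ⊆ z.1 <;> simp [hx, hy]
  rw [sum_congr rfl fun z _ => h1 z, ← sum_filter, sum_faces_subset G
    (fun _ => x.2) fun s => if y.1 ⊆ s then (-1 : ℝ) ^ (#s + 1) else 0, ← sum_filter,
    filter_filter]
  -- Since y is non-empty, passing from the Boolean lattice to faces loses nothing from the
  -- interval.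
  have hIcc : (x.1.powerset.filter fun s => s.Nonempty ∧ y.1 ⊆ s) = Icc y.1 x.1 := by
    ext s
    simp only [mem_filter, mem_powerset, mem_Icc]
    exact ⟨fun h => ⟨h.2.2, h.1⟩, fun h => ⟨h.2, (G.isRelLowerSet_faces y.2).1.mono h.1, h.1⟩⟩
  rw [hIcc]
  by_cases hyx : y.1 ⊆ x.1
  · have h3 := congrArg (Int.cast : ℤ → ℝ) (sum_Icc_neg_one_pow_card hyx)
    push_cast at h3
    simp only [pow_succ, ← sum_mul, h3]
    by_cases h : x = y
    · simp [h]
    · have h' : y.1 ≠ x.1 := fun e => h (Subtype.ext e.symm)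
      simp [h, h']
  · have h : x ≠ y := fun e => hyx (by rw [e])
    rw [Icc_eq_empty hyx, sum_empty, diagonal_apply_ne _ h]

/-- The Green function of the connection Laplacian. -/
theorem connectionLaplacian_mul_eq_one :
    connectionLaplacian G *
      (parityMatrix G * (zetaMatrix G)ᵀ * parityMatrix G * zetaMatrix G * parityMatrix G) = 1 := by
  have h1 := zetaMatrix_mul_parityMatrix_mul_zetaMatrix G
  have h2 := congrArg Matrix.transpose h1
  have hD : (parityMatrix G)ᵀ = parityMatrix G := diagonal_transpose _
  have hDD := parityMatrix_mul_self G
  rw [transpose_mul, transpose_mul, hD] at h2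
  rw [connectionLaplacian_eq]
  -- The transposed identity Zᵀ D Zᵀ = D collapses the middle; D² = 1 and Z D Z = D do the rest.
  calc _ = zetaMatrix G * parityMatrix G *
        ((zetaMatrix G)ᵀ * (parityMatrix G * (zetaMatrix G)ᵀ)) *
        parityMatrix G * zetaMatrix G * parityMatrix G := by simp only [Matrix.mul_assoc]
    _ = zetaMatrix G * (parityMatrix G * parityMatrix G) * parityMatrix G * zetaMatrix G *
        parityMatrix G := by rw [h2]; simp only [Matrix.mul_assoc]
    _ = 1 := by rw [hDD, Matrix.mul_one, h1, hDD]

theorem isUnit_det_connectionLaplacian : IsUnit (connectionLaplacian G).det :=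
  Matrix.isUnit_det_of_right_inverse (connectionLaplacian_mul_eq_one G)

theorem trace_inv_connectionLaplacian :
    (connectionLaplacian G)⁻¹.trace =
      ((∑ z : G.faces, - ((-1 : ℤ) ^ #z.1 * (2 ^ #z.1 - 1)) : ℤ) : ℝ) := by
  rw [Matrix.inv_eq_right_inv (connectionLaplacian_mul_eq_one G), trace_mul_comm]
  simp only [← Matrix.mul_assoc]
  rw [parityMatrix_mul_self, Matrix.one_mul, Matrix.trace_mul_comm, Matrix.trace]
  push_cast
  refine sum_congr rfl fun z _ => ?_
  rw [diag_apply, Matrix.mul_apply]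
  simp only [parityMatrix, mul_diagonal, zetaMatrix, transpose_apply, of_apply]
  have h1 : ∀ w : G.faces, ((if w.1 ⊆ z.1 then 1 else 0) * ((if w.1 ⊆ z.1 then 1 else 0) *
      (-1) ^ (#z.1 + 1)) : ℝ) = if w.1 ⊆ z.1 then (-1) ^ (#z.1 + 1) else 0 := by
    intro w
    by_cases h : w.1 ⊆ z.1 <;> simp [h]
  rw [sum_congr rfl fun w _ => h1 w, ← sum_filter,
    sum_faces_subset G (fun _ => z.2) fun _ => (-1 : ℝ) ^ (#z.1 + 1), sum_powerset_nonempty]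
  simp [card_powerset]
  ring

theorem trace_connectionLaplacian : (connectionLaplacian G).trace = Fintype.card G.faces := by
  simp [Matrix.trace, connectionLaplacian_apply,
    fun x : G.faces => (G.isRelLowerSet_faces x.2).1.ne_empty]

end Laplacian

/-! ### Comparison with the f-vector of the barycentric refinement -/

section Barycentric

variable {ι : Type*} (G : PreAbstractSimplicialComplex ι)

theorem mem_whitneyComplex_barycentricGraph (y : Finset G.faces) :
    y ∈ (whitneyComplex (barycentricGraph G)).faces ↔
      y.Nonempty ∧ IsChain (· ≤ ·) (y : Set G.faces) :=
  and_congr_right fun _ =>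
    ⟨fun h _ ha _ hb hab => (h ha hb hab).2, fun h _ ha _ hb hab => ⟨hab, h ha hb hab⟩⟩

variable [DecidableEq ι] [Fintype G.faces]

theorem eval_derivative_zero_barycentricGraph :
    (generatingFunction (whitneyComplex (barycentricGraph G))).derivative.eval 0 =
      Fintype.card G.faces := by
  classical
  rw [eval_derivative_generatingFunction]
  -- The convention 0^0 = 1 selects exactly the singletons.
  have h : ∀ s ∈ univ.filter (· ∈ (whitneyComplex (barycentricGraph G)).faces),
      (#s : ℝ) * 0 ^ (#s - 1) = if #s = 1 then 1 else 0 := by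
    intro s hs
    have := (mem_filter.1 hs).2.1.card_pos
    by_cases h1 : #s = 1
    · simp [h1]
    · rw [if_neg h1, zero_pow (by omega), mul_zero]
  rw [sum_congr rfl h, ← sum_filter, sum_const, nsmul_eq_mul, mul_one, ← card_univ (α := G.faces),
    ← card_map (f := ⟨fun x : G.faces => ({x} : Finset G.faces), singleton_injective⟩)]
  congr 2
  ext s
  simp only [mem_filter, mem_univ, true_and, mem_map, Function.Embedding.coeFn_mk, card_eq_one]
  constructor
  · rintro ⟨_, a, rfl⟩
    exact ⟨a, rfl⟩
  · rintro ⟨a, rfl⟩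
    exact ⟨(mem_whitneyComplex_barycentricGraph G _).2 (by simp), a, rfl⟩

theorem trace_inv_eq_eval_derivative :
    (connectionLaplacian G)⁻¹.trace =
      (generatingFunction (whitneyComplex (barycentricGraph G))).derivative.eval (-1) := by
  classical
  rw [trace_inv_connectionLaplacian, eval_derivative_generatingFunction]
  simp only [← chainSum_mul_neg_one_pow, sum_neg_distrib]
  have h := sum_chainSum (α := G.faces) (fun n => n * (-1) ^ n) fun _ => True
  simp only [filter_true, implies_true, and_true] at h
  rw [h]
  simp only [mem_whitneyComplex_barycentricGraph]
  push_cast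
  rw [← sum_neg_distrib]
  refine sum_congr rfl fun s hs => ?_
  obtain ⟨n, hn⟩ := Nat.exists_eq_add_one.2 (mem_filter.1 hs).2.1.card_pos
  rw [hn, Nat.add_sub_cancel, pow_succ]
  ring

theorem eta_eq_eval_derivative_sub :
    eta G = (generatingFunction (whitneyComplex (barycentricGraph G))).derivative.eval 0 -
      (generatingFunction (whitneyComplex (barycentricGraph G))).derivative.eval (-1) := by
  rw [eta, Matrix.trace_sub, trace_connectionLaplacian, eval_derivative_zero_barycentricGraph,
    trace_inv_eq_eval_derivative]

end Barycentric

end HydrogenTrace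

theorem mainTheorem2 {ι : Type*} [DecidableEq ι] (G : PreAbstractSimplicialComplex ι)
    [Fintype G.faces] :
    -- the connection Laplacian is invertible, so that its inverse is a genuine inverse
    IsUnit (HydrogenTrace.connectionLaplacian G).det ∧
    -- `η(G) = f₁'(0) - f₁'(-1)`
    HydrogenTrace.eta G =
      (HydrogenTrace.generatingFunction (HydrogenTrace.whitneyComplex
        (HydrogenTrace.barycentricGraph G))).derivative.eval 0 -
      (HydrogenTrace.generatingFunction (HydrogenTrace.whitneyComplex
        (HydrogenTrace.barycentricGraph G))).derivative.eval (-1) ∧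
    -- `η(G) = 2 v₁ - 3 v₂ + 4 v₃ - ⋯` for the `f`-vector of `G₁`
    HasSum (fun k : ℕ => (-1 : ℝ) ^ k * (k + 2) *
      (HydrogenTrace.fVector (HydrogenTrace.whitneyComplex
        (HydrogenTrace.barycentricGraph G)) (k + 1) : ℝ)) (HydrogenTrace.eta G) ∧
    -- `tr(L⁻¹) = f₁'(-1)`
    (HydrogenTrace.connectionLaplacian G)⁻¹.trace =
      (HydrogenTrace.generatingFunction (HydrogenTrace.whitneyComplex
        (HydrogenTrace.barycentricGraph G))).derivative.eval (-1) ∧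
    -- `η(G)` is the sum of the Euler characteristics of the unit spheres of `G₁`
    HydrogenTrace.eta G =
      ((∑ x : G.faces, HydrogenTrace.eulerChar (HydrogenTrace.whitneyComplex
        (HydrogenTrace.unitSphere (HydrogenTrace.barycentricGraph G) x)) : ℤ) : ℝ) ∧
    -- the handshake identity, over the simplices of positive dimension of `G₁`
    ∑ x : G.faces, HydrogenTrace.eulerChar (HydrogenTrace.whitneyComplex
        (HydrogenTrace.unitSphere (HydrogenTrace.barycentricGraph G) x)) =
      ∑ᶠ y ∈ {y ∈ (HydrogenTrace.whitneyComplex (HydrogenTrace.barycentricGraph G)).faces |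
          0 < HydrogenTrace.dim y},
        (-1 : ℤ) ^ (1 + HydrogenTrace.dim y) * (1 + (HydrogenTrace.dim y : ℤ)) := by
  classical
  have heta := HydrogenTrace.eta_eq_eval_derivative_sub G
  have hsum := heta.trans
    (HydrogenTrace.eval_derivative_zero_sub_eval_derivative_neg_one _)
  refine ⟨HydrogenTrace.isUnit_det_connectionLaplacian G, heta, ?_,
    HydrogenTrace.trace_inv_eq_eval_derivative G, ?_, ?_⟩
  · rw [hsum]
    exact HydrogenTrace.hasSum_fVector _
  · rw [HydrogenTrace.sum_eulerChar_unitSphere, hsum]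
  · rw [HydrogenTrace.sum_eulerChar_unitSphere, ← finsum_mem_finset_eq_sum]
    simp only [Finset.mem_filter, Finset.mem_univ, true_and, Set.mem_ofPred_eq]
    refine finsum_mem_congr (by ext; simp) fun y hy => ?_
    rw [← HydrogenTrace.dim_add_one hy.1]
    push_cast
    ring
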